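/- **Definitions.** A \emph{crossed module} $(B,D,d,\theta)$ consists of groups $B$ (written additively) and $D$ (written multiplicatively) and homomorphisms $d:B\to D$, $\theta:D\to \mathrm{Aut}(B)$ such that $\theta_{d(b)}$ is conjugation by $b$ and $d(\theta_x(b))=x\,d(b)\,x^{-1}$ for all $b\in B$, $x\in D$. Then $d(B)$ is normal in $D$, $\mathrm{Ker}\,d$ is central in $B$, and $\mathrm{Ker}\,d$ is a $\mathrm{Coker}\,d$-module through $sa=\theta_x(a)$ for $x\in s$. A morphism $(f_1,f_0):(B,D,d,\theta)\to(B',D',d',\theta')$ is a pair of group homomorphisms $f_1:B\to B'$, $f_0:D\to D'$ with $f_0d=d'f_1$ and $f_1(\theta_x b)=\theta'_{f_0(x)}f_1(b)$. The strict Gr-category $\mathbb P=\mathbb P_{B\to D}$ associated to the crossed module has the elements of $D$ as objects and $\mathrm{Hom}(x,y)=\{b\in B: x=d(b)y\}$; the composite of $x\xrightarrow{b}y\xrightarrow{c}z$ is $b+c$; the tensor product is the multiplication of $D$ on objects and $(x\xrightarrow{b}y)\otimes(x'\xrightarrow{b'}y')=(xx'\xrightarrow{b+\theta_yb'}yy')$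 on morphisms; all constraints are identities. A \emph{stick} of $\mathbb P$ is a choice of representatives $x_s\in s$ $(s\in\mathrm{Coker}\,d)$ with $x_1=1$ and of isomorphisms $i_x:x_s\to x$ for all $x\in s$, with $i_{x_s}=\mathrm{id}$ and compatible with the unit constraints. Transporting the structure of $\mathbb P$ along the isomorphisms $i_{x_s\otimes x_t}:x_{st}\to x_s\otimes x_t$ gives the \emph{reduced} Gr-category of $\mathbb P$, whose objects are the elements of $\mathrm{Coker}\,d$ and whose morphisms are the automorphisms $(s,u):s\to s$, $u\in\mathrm{Ker}\,d$. Its associativity constraint is $(srt,k(s,r,t)): s\otimes(r\otimes t)\to(s\otimes r)\otimes t$, where $k\in Z^3(\mathrm{Coker}\,d,\mathrm{Ker}\,d)$ is a $3$-cocycle. An \emph{extension of $B$ by $Q$ of type $B\to D$} is a short exact sequence of groups $0\to B\xrightarrow{j}E\xrightarrow{p}Q\to1$ with a homomorphism $\varepsilon:E\to D$ such that $(\mathrm{id}_B,\varepsilon)$ is a morphism of crossed modules from $(B,E,j,\theta')$ to $(B,D,d,\theta)$, where $\theta'$ is given by conjugation in $E$. It \emph{induces} $\psi:Q\to\mathrm{Coker}\,d$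 if $q\varepsilon=\psi p$, where $q:D\to\mathrm{Coker}\,d$ is the projection. Two such extensions are \emph{equivalent} if there is a homomorphism $\eta:E\to E'$ with $\eta j=j'$, $p'\eta=p$ and $\varepsilon'\eta=\varepsilon$. **Theorem (Brown–Mucuk).** Let $(B,D,d,\theta)$ be a crossed module, let $Q$ be a group and $\psi:Q\to\mathrm{Coker}\,d$ a group homomorphism. Let $k\in Z^3(\mathrm{Coker}\,d,\mathrm{Ker}\,d)$ be the $3$-cocycle of the reduced Gr-category of $\mathbb P_{B\to D}$ with respect to any stick, and write $H^n_\psi(Q,\mathrm{Ker}\,d)$ for the cohomology of $Q$ with coefficients in $\mathrm{Ker}\,d$, on which $Q$ acts through $\psi$. Then the vanishing of the class $\overline{\psi^*k}$ in $H^3_\psi(Q,\mathrm{Ker}\,d)$ is necessary and sufficient for there to exist an extension of $B$ by $Q$ of type $B\to D$ inducing $\psi$. Further, if $\overline{\psi^*k}$ vanishes, then the set of equivalence classes of such extensions is in bijection with $H^2_\psi(Q,\mathrm{Ker}\,d)$. -/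

import Mathlib

open CategoryTheory MonoidalCategory

universe u

/-- A crossed module `(B, D, d, θ)`; both groups are written multiplicatively. -/
structure CrossedModule (B D : Type*) [Group B] [Group D] where
  /-- the boundary map -/
  d : B →* D
  /-- the action of `D` on `B` -/
  θ : D →* MulAut B
  /-- `θ ∘ d = μ`, where `μ` is conjugation in `B` -/
  θ_d : ∀ b : B, θ (d b) = MulAut.conj b
  /-- `d (θ_x b) = μ_x (d b)` -/
  d_θ : ∀ (x : D) (b : B), d (θ x b) = x * d b * x⁻¹

namespace CrossedModule

/-- `(f₁, f₀)` is a morphism of crossed modules. -/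
structure IsHom {B D B' D' : Type*} [Group B] [Group D] [Group B'] [Group D']
    (X : CrossedModule B D) (X' : CrossedModule B' D') (f₁ : B →* B') (f₀ : D →* D') : Prop where
  comm : ∀ b : B, f₀ (X.d b) = X'.d (f₁ b)
  equivariant : ∀ (x : D) (b : B), f₁ (X.θ x b) = X'.θ (f₀ x) (f₁ b)

variable {B D : Type u} [Group B] [Group D] (X : CrossedModule B D)

/-! ### `Ker d` as a module over `Coker d` -/

instance normal_range : X.d.range.Normal where
  conj_mem := by
    rintro _ ⟨b, rfl⟩ x
    exact ⟨X.θ x b, X.d_θ x b⟩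

/-- `Coker d = D / d(B)`. -/
abbrev Coker : Type u := D ⧸ X.d.range

theorem comm_of_mem_ker {a : B} (ha : X.d a = 1) (b : B) : a * b = b * a := by
  have h := congrArg (fun f : MulAut B => f b) (X.θ_d a)
  simp only [ha, map_one, MulAut.one_apply, MulAut.conj_apply] at h
  exact (eq_mul_inv_iff_mul_eq.mp h).symm

instance commGroupKer : CommGroup X.d.ker where
  mul_comm a b := Subtype.ext (X.comm_of_mem_ker a.2 b)

/-- The action of `D` on `Ker d` by restriction of `θ`. -/
def kerAct : D →* (Additive X.d.ker →ₗ[ULift.{u} ℤ] Additive X.d.ker) where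
  toFun x :=
    { toFun := fun a => Additive.ofMul ⟨X.θ x a.toMul.1, by
        have := a.toMul.2
        rw [MonoidHom.mem_ker] at this ⊢
        rw [X.d_θ, this]; group⟩
      map_add' := fun a b => Additive.toMul.injective (Subtype.ext (map_mul (X.θ x) _ _))
      map_smul' := fun n a =>
        Additive.toMul.injective (Subtype.ext (map_zpow (X.θ x) _ n.down)) }
  map_one' := by
    ext a; simp
  map_mul' x y := by
    ext a; simp

theorem kerAct_apply (x : D) (a : Additive X.d.ker) :
    (((X.kerAct x a).toMul : X.d.ker) : B) = X.θ x a.toMul.1 := rfl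

/-- The action of `Coker d` on `Ker d`: `s a = θ_x a` for `x ∈ s`. -/
def cokerAct : Representation (ULift.{u} ℤ) X.Coker (Additive X.d.ker) :=
  QuotientGroup.lift X.d.range X.kerAct (by
    rintro _ ⟨b, rfl⟩
    ext a
    show X.θ (X.d b) a.toMul.1 = a.toMul.1
    rw [X.θ_d, MulAut.conj_apply, ← X.comm_of_mem_ker a.toMul.2, mul_inv_cancel_right])

/-- The `Coker d`-module `Ker d`. (`ULift ℤ` is the ring of integers, placed in the universe of
the groups.) -/
abbrev kerRep : Rep.{u} (ULift.{u} ℤ) X.Coker := Rep.of X.cokerAct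

/-- The action of `Coker d` on `Ker d`, in multiplicative notation. -/
def act (s : X.Coker) (u : X.d.ker) : X.d.ker := (X.cokerAct s (Additive.ofMul u)).toMul

@[simp] theorem act_mk (x : D) (u : X.d.ker) : (X.act (QuotientGroup.mk x) u).1 = X.θ x u.1 := rfl

@[simp] theorem act_one (u : X.d.ker) : X.act 1 u = u := by
  simp [act]

theorem act_mul (s t : X.Coker) (u : X.d.ker) : X.act (s * t) u = X.act s (X.act t u) := by
  simp [act]

@[simp] theorem act_map_one (s : X.Coker) : X.act s 1 = 1 := by
  simp [act]

@[simp] theorem act_map_mul (s : X.Coker) (u v : X.d.ker) :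
    X.act s (u * v) = X.act s u * X.act s v := by
  simp [act]

@[simp] theorem act_map_inv (s : X.Coker) (u : X.d.ker) : X.act s u⁻¹ = (X.act s u)⁻¹ := by
  simp [act]

/-! ### The strict Gr-category associated to a crossed module -/

/-- The objects of the Gr-category `ℙ` associated to `X`: the elements of `D`. -/
@[ext]
structure Gr (X : CrossedModule B D) where
  /-- the underlying element of `D` -/
  val : D

namespace Gr

variable {X}

/-- A morphism `x ⟶ y` of `ℙ`: an element `b ∈ B` with `x = d(b) y`. -/
@[ext]
structure Hom (x y : X.Gr) where
  /-- the underlying element of `B` -/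
  label : B
  eq : x.val = X.d label * y.val

/-- Composition is the operation of `B`; every morphism is invertible. -/
instance : Groupoid X.Gr where
  Hom := Hom
  id x := ⟨1, by simp⟩
  comp f g := ⟨f.label * g.label, by rw [f.eq, g.eq, map_mul, mul_assoc]⟩
  inv f := ⟨f.label⁻¹, by rw [f.eq, map_inv, inv_mul_cancel_left]⟩
  id_comp _ := Hom.ext (one_mul _)
  comp_id _ := Hom.ext (mul_one _)
  assoc _ _ _ := Hom.ext (mul_assoc _ _ _)
  inv_comp _ := Hom.ext (inv_mul_cancel _)
  comp_inv _ := Hom.ext (mul_inv_cancel _)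

@[ext]
theorem hom_ext {x y : X.Gr} {f g : x ⟶ y} (h : f.label = g.label) : f = g := Hom.ext h

@[simp] theorem label_id (x : X.Gr) : Hom.label (𝟙 x) = 1 := rfl

@[simp] theorem label_comp {x y z : X.Gr} (f : x ⟶ y) (g : y ⟶ z) :
    (f ≫ g).label = f.label * g.label := rfl

@[simp] theorem label_eqToHom {x y : X.Gr} (h : x = y) : (eqToHom h).label = 1 := by
  subst h; rfl

@[simp] theorem label_inv {x y : X.Gr} (f : x ≅ y) : f.inv.label = f.hom.label⁻¹ := by
  rw [eq_inv_iff_mul_eq_one, ← label_comp, f.inv_hom_id, label_id]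

/-- The tensor product: multiplication of `D` on objects, and
`(x –b→ y) ⊗ (x' –b'→ y') = (x x' –(b + θ_y b')→ y y')` on morphisms. -/
instance : MonoidalCategoryStruct X.Gr where
  tensorObj x y := ⟨x.val * y.val⟩
  tensorUnit := ⟨1⟩
  tensorHom {x y x' y'} f g := ⟨f.label * X.θ y.val g.label, by
    simp only [map_mul, X.d_θ]
    rw [f.eq, g.eq]; group⟩
  whiskerLeft x {y y'} g := ⟨X.θ x.val g.label, by
    simp only [X.d_θ]
    rw [g.eq]; group⟩
  whiskerRight {x x'} f y := ⟨f.label, by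
    show x.val * y.val = X.d f.label * (x'.val * y.val)
    rw [f.eq, mul_assoc]⟩
  associator x y z := eqToIso (Gr.ext (mul_assoc _ _ _))
  leftUnitor x := eqToIso (Gr.ext (one_mul _))
  rightUnitor x := eqToIso (Gr.ext (mul_one _))

@[simp] theorem val_tensor (x y : X.Gr) : (x ⊗ y).val = x.val * y.val := rfl

@[simp] theorem val_unit : (𝟙_ X.Gr).val = 1 := rfl

@[simp] theorem label_tensorHom {x y x' y' : X.Gr} (f : x ⟶ y) (g : x' ⟶ y') :
    (f ⊗ₘ g).label = f.label * X.θ y.val g.label := rfl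

@[simp] theorem label_whiskerLeft (x : X.Gr) {y z : X.Gr} (f : y ⟶ z) :
    (x ◁ f).label = X.θ x.val f.label := rfl

@[simp] theorem label_whiskerRight {x y : X.Gr} (f : x ⟶ y) (z : X.Gr) :
    (f ▷ z).label = f.label := rfl

@[simp] theorem label_associator_hom (x y z : X.Gr) : (α_ x y z).hom.label = 1 :=
  label_eqToHom (Gr.ext (mul_assoc _ _ _))

@[simp] theorem label_leftUnitor_hom (x : X.Gr) : (λ_ x).hom.label = 1 :=
  label_eqToHom (Gr.ext (one_mul _))

@[simp] theorem label_rightUnitor_hom (x : X.Gr) : (ρ_ x).hom.label = 1 :=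
  label_eqToHom (Gr.ext (mul_one _))

theorem θ_mul_label {x y : X.Gr} (f : x ⟶ y) (b : B) :
    X.θ x.val b * f.label = f.label * X.θ y.val b := by
  rw [f.eq, map_mul, X.θ_d, MulAut.mul_apply, MulAut.conj_apply, inv_mul_cancel_right]

/-- The associated strict Gr-category: the constraints are identities. -/
instance : MonoidalCategory X.Gr where
  tensorHom_def f g := by ext; simp
  id_tensorHom_id x y := by ext; simp
  tensorHom_comp_tensorHom {x₁ y₁ z₁ x₂ y₂ z₂} f₁ f₂ g₁ g₂ := by
    ext
    have h := θ_mul_label g₁ (f₂.label)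
    simp only [label_tensorHom, label_comp, map_mul]
    rw [mul_assoc, ← mul_assoc (X.θ _ _) g₁.label, h]
    simp only [mul_assoc]
  whiskerLeft_id x y := by ext; simp
  id_whiskerRight x y := by ext; simp
  associator_naturality f g h := by ext; simp [mul_assoc]
  leftUnitor_naturality f := by ext; simp
  rightUnitor_naturality f := by ext; simp
  pentagon x y z w := by ext; simp
  triangle x y := by ext; simp

/-- The class `[x] ∈ π₀ ℙ = Coker d` of an object. -/
def cls (x : X.Gr) : X.Coker := QuotientGroup.mk x.val

@[simp] theorem cls_tensor (x y : X.Gr) : (x ⊗ y).cls = x.cls * y.cls := rfl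

@[simp] theorem cls_unit : (𝟙_ X.Gr).cls = 1 := rfl

/-- `π₀ ℙ = Coker d`: two objects are isomorphic iff they have the same class. -/
theorem cls_eq_iff (x y : X.Gr) : x.cls = y.cls ↔ Nonempty (x ≅ y) := by
  constructor
  · intro h
    have h' : (QuotientGroup.mk y.val : X.Coker) = QuotientGroup.mk x.val := h.symm
    obtain ⟨b, hb⟩ := QuotientGroup.eq.mp h'
    refine ⟨(Groupoid.isoEquivHom x y).symm ⟨X.θ y.val b, ?_⟩⟩
    rw [X.d_θ, hb]; group
  · rintro ⟨f⟩
    refine (QuotientGroup.eq.mpr ⟨(X.θ x.val⁻¹) f.hom.label⁻¹, ?_⟩)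
    rw [X.d_θ, f.hom.eq]; simp

/-- `π₁ ℙ = Ker d`: the automorphism of the unit object with a given label. -/
def unitEnd (u : X.d.ker) : 𝟙_ X.Gr ⟶ 𝟙_ X.Gr :=
  ⟨u.1, by rw [MonoidHom.mem_ker.mp u.2, one_mul]⟩

theorem unitEnd_bijective :
    Function.Bijective (unitEnd : X.d.ker → (𝟙_ X.Gr ⟶ 𝟙_ X.Gr)) :=
  ⟨fun _ _ h => Subtype.ext (congrArg Hom.label h),
    fun f => ⟨⟨f.label, by
      have h := f.eq
      rwa [right_eq_mul, ← MonoidHom.mem_ker] at h⟩, rfl⟩⟩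

/-- `γ_x(u) : x ⟶ x`, obtained from `u ⊗ x` through the left unit constraint. -/
def gamma (x : X.Gr) (u : X.d.ker) : x ⟶ x := (λ_ x).inv ≫ unitEnd u ▷ x ≫ (λ_ x).hom

/-- `δ_x(u) : x ⟶ x`, obtained from `x ⊗ u` through the right unit constraint. -/
def delta (x : X.Gr) (u : X.d.ker) : x ⟶ x := (ρ_ x).inv ≫ x ◁ unitEnd u ≫ (ρ_ x).hom

@[simp] theorem label_gamma (x : X.Gr) (u : X.d.ker) : (gamma x u).label = u.1 := by
  simp [gamma, unitEnd]

@[simp] theorem label_delta (x : X.Gr) (u : X.d.ker) : (delta x u).label = X.θ x.val u.1 := by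
  simp [delta, unitEnd]

theorem gamma_bijective (x : X.Gr) : Function.Bijective (gamma x) := by
  constructor
  · intro u v h
    apply Subtype.ext
    have := congrArg Hom.label h
    simpa only [label_gamma] using this
  · intro f
    refine ⟨⟨f.label, ?_⟩, by ext; simp⟩
    have h := f.eq
    rwa [right_eq_mul, ← MonoidHom.mem_ker] at h

/-- The action of `π₀ ℙ` on `π₁ ℙ`, `[x] u = γ_x⁻¹ (δ_x u)`, is that of `Coker d` on `Ker d`. -/
theorem gamma_act (x : X.Gr) (u : X.d.ker) :
    gamma x (X.act x.cls u) = delta x u := by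
  ext
  simp only [label_gamma, label_delta]
  rfl

end Gr

/-! ### Sticks and the reduced Gr-category -/

/-- A stick `(x_s, i_x)` of `ℙ`: representatives `x_s ∈ s` with `x_1 = I`, and isomorphisms
`i_x : x_s ⟶ x` for `x ∈ s`, with `i_{x_s} = id` and compatible with the unit constraints. -/
structure Stick where
  /-- the representative `x_s` -/
  obj : X.Coker → X.Gr
  cls_obj : ∀ s, (obj s).cls = s
  /-- the isomorphism `i_x` -/
  iso : ∀ x : X.Gr, obj x.cls ≅ x
  obj_one : obj 1 = 𝟙_ X.Gr
  iso_obj : ∀ s, (iso (obj s)).hom = eqToHom (by rw [cls_obj])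
  iso_unit_tensor : ∀ s, (iso (𝟙_ X.Gr ⊗ obj s)).hom =
    eqToHom (by rw [Gr.cls_tensor, Gr.cls_unit, one_mul, cls_obj]) ≫ (λ_ (obj s)).inv
  iso_tensor_unit : ∀ s, (iso (obj s ⊗ 𝟙_ X.Gr)).hom =
    eqToHom (by rw [Gr.cls_tensor, Gr.cls_unit, mul_one, cls_obj]) ≫ (ρ_ (obj s)).inv

namespace Stick

variable {X} (σ : X.Stick)

/-- `i_{x_s ⊗ x_t} : x_{st} ⟶ x_s ⊗ x_t`; its inverse is the monoidal constraint of `H`. -/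
def mu (s t : X.Coker) : σ.obj (s * t) ≅ σ.obj s ⊗ σ.obj t :=
  eqToIso (by rw [Gr.cls_tensor, σ.cls_obj, σ.cls_obj]) ≪≫ σ.iso (σ.obj s ⊗ σ.obj t)

/-- The associativity constraint `x_s ⊗ (x_r ⊗ x_t) ⟶ (x_s ⊗ x_r) ⊗ x_t` of `ℙ`, transported to an
automorphism of `x_{srt}` along the isomorphisms `x_{st} ⟶ x_s ⊗ x_t`. -/
def assocEnd (s r t : X.Coker) : σ.obj (s * r * t) ⟶ σ.obj (s * r * t) :=
  eqToHom (by rw [mul_assoc]) ≫ (σ.mu s (r * t)).hom ≫ σ.obj s ◁ (σ.mu r t).hom ≫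
    (α_ (σ.obj s) (σ.obj r) (σ.obj t)).inv ≫ (σ.mu s r).inv ▷ σ.obj t ≫ (σ.mu (s * r) t).inv

/-- The function `k`: the associativity constraint of the reduced Gr-category is
`a_{s,r,t} = (srt, k(s,r,t))`, where `γ_{x_{srt}}(k(s,r,t))` is the transported constraint. -/
noncomputable def k (s r t : X.Coker) : X.d.ker :=
  (Equiv.ofBijective _ (Gr.gamma_bijective (σ.obj (s * r * t)))).symm (σ.assocEnd s r t)

theorem gamma_k (s r t : X.Coker) :
    Gr.gamma (σ.obj (s * r * t)) (σ.k s r t) = σ.assocEnd s r t :=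
  (Equiv.ofBijective _ (Gr.gamma_bijective (σ.obj (s * r * t)))).apply_symm_apply _

/-- The label `m(s,t) ∈ B` of `i_{x_s ⊗ x_t}`. -/
def lab (s t : X.Coker) : B := (σ.mu s t).hom.label

theorem act_eq (s : X.Coker) (u : X.d.ker) : (X.act s u).1 = X.θ (σ.obj s).val u.1 := by
  conv_lhs => rw [← σ.cls_obj s]
  rfl

theorem lab_eq (s t : X.Coker) :
    (σ.obj (s * t)).val = X.d (σ.lab s t) * ((σ.obj s).val * (σ.obj t).val) :=
  (σ.mu s t).hom.eq

theorem k_mul (s r t : X.Coker) :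
    (σ.k s r t).1 * (σ.lab (s * r) t * σ.lab s r) =
      σ.lab s (r * t) * X.θ (σ.obj s).val (σ.lab r t) := by
  have h := congrArg Gr.Hom.label (σ.gamma_k s r t)
  simp only [Gr.label_gamma, assocEnd, Gr.label_comp, Gr.label_eqToHom, Gr.label_whiskerLeft,
    Gr.label_inv, Gr.label_whiskerRight, Gr.label_associator_hom] at h
  rw [h]
  simp only [lab]
  group

theorem k_cocycle (s r t v : X.Coker) :
    X.act s (σ.k r t v) * σ.k s (r * t) v * σ.k s r t = σ.k (s * r) t v * σ.k s r (t * v) := by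
  apply Subtype.ext
  apply mul_right_cancel (b := σ.lab (s * r * t) v * σ.lab (s * r) t * σ.lab s r)
  have e1 := congrArg (X.θ (σ.obj s).val) (σ.k_mul r t v)
  have e2 := σ.k_mul s (r * t) v
  have e3 := σ.k_mul s r t
  have e4 := σ.k_mul (s * r) t v
  have e5 := σ.k_mul s r (t * v)
  have e6 : σ.lab s r * X.θ (σ.obj s).val (X.θ (σ.obj r).val (σ.lab t v)) =
      X.θ (σ.obj (s * r)).val (σ.lab t v) * σ.lab s r := by
    rw [σ.lab_eq s r]
    simp only [map_mul, X.θ_d, MulAut.mul_apply, MulAut.conj_apply]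
    group
  have c1 : ∀ b, b * X.θ (σ.obj s).val (σ.k r t v) = X.θ (σ.obj s).val (σ.k r t v) * b := by
    intro b
    rw [← σ.act_eq]
    exact (X.comm_of_mem_ker (X.act s (σ.k r t v)).2 b).symm
  have c2 : ∀ b, b * (σ.k s r t).1 = (σ.k s r t).1 * b := fun b =>
    (X.comm_of_mem_ker (σ.k s r t).2 b).symm
  have c3 : ∀ b, b * (σ.k s r (t * v)).1 = (σ.k s r (t * v)).1 * b := fun b =>
    (X.comm_of_mem_ker (σ.k s r (t * v)).2 b).symm
  simp only [map_mul] at e1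
  simp only [mul_assoc] at e1 e2 e3 e4 e5
  calc ((X.act s (σ.k r t v) * σ.k s (r * t) v * σ.k s r t : X.d.ker) : B) *
        (σ.lab (s * r * t) v * σ.lab (s * r) t * σ.lab s r)
      = X.θ (σ.obj s).val (σ.k r t v) * ((σ.k s (r * t) v).1 *
          (((σ.k s r t).1 * σ.lab (s * (r * t)) v) * (σ.lab (s * r) t * σ.lab s r))) := by
        simp only [Subgroup.coe_mul, σ.act_eq, mul_assoc]
    _ = X.θ (σ.obj s).val (σ.k r t v) * (((σ.k s (r * t) v).1 *
          (σ.lab (s * (r * t)) v * σ.lab s (r * t))) * X.θ (σ.obj s).val (σ.lab r t)) := by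
        rw [← c2, mul_assoc _ (σ.k s r t).1, e3]; simp only [mul_assoc]
    _ = X.θ (σ.obj s).val (σ.k r t v) * (σ.lab s (r * (t * v)) *
          (X.θ (σ.obj s).val (σ.lab (r * t) v) * X.θ (σ.obj s).val (σ.lab r t))) := by
        rw [e2]; simp only [mul_assoc]
    _ = σ.lab s (r * (t * v)) * (X.θ (σ.obj s).val (σ.lab r (t * v)) *
          X.θ (σ.obj s).val (X.θ (σ.obj r).val (σ.lab t v))) := by
        rw [← mul_assoc, ← c1, mul_assoc, e1]
    _ = (σ.k s r (t * v)).1 * (σ.lab (s * r) (t * v) *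
          (X.θ (σ.obj (s * r)).val (σ.lab t v) * σ.lab s r)) := by
        rw [← mul_assoc, ← e5, ← e6]; simp only [mul_assoc]
    _ = (σ.k s r (t * v)).1 * ((σ.k (s * r) t v).1 *
          (σ.lab (s * (r * t)) v * σ.lab (s * r) t * σ.lab s r)) := by
        congr 1
        calc _ = (σ.k (s * r) t v).1 * (σ.lab (s * (r * t)) v * σ.lab (s * r) t) * σ.lab s r := by
              rw [e4]; simp only [mul_assoc]
          _ = _ := by simp only [mul_assoc]
    _ = _ := by
        rw [← mul_assoc, ← c3]; simp only [Subgroup.coe_mul, mul_assoc]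

@[simp] theorem lab_one_left (s : X.Coker) : σ.lab 1 s = 1 := by
  have h : ∀ x : X.Gr, x = 𝟙_ X.Gr ⊗ σ.obj s → (σ.iso x).hom.label = 1 := by
    rintro x rfl
    rw [σ.iso_unit_tensor, Gr.label_comp, Gr.label_eqToHom, Gr.label_inv,
      Gr.label_leftUnitor_hom, inv_one, mul_one]
  simp only [lab, mu, Iso.trans_hom, eqToIso.hom, Gr.label_comp, Gr.label_eqToHom, one_mul]
  exact h _ (by rw [σ.obj_one])

@[simp] theorem lab_one_right (s : X.Coker) : σ.lab s 1 = 1 := by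
  have h : ∀ x : X.Gr, x = σ.obj s ⊗ 𝟙_ X.Gr → (σ.iso x).hom.label = 1 := by
    rintro x rfl
    rw [σ.iso_tensor_unit, Gr.label_comp, Gr.label_eqToHom, Gr.label_inv,
      Gr.label_rightUnitor_hom, inv_one, mul_one]
  simp only [lab, mu, Iso.trans_hom, eqToIso.hom, Gr.label_comp, Gr.label_eqToHom, one_mul]
  exact h _ (by rw [σ.obj_one])

theorem k_one_mid (s t : X.Coker) : σ.k s 1 t = 1 := by
  apply Subtype.ext
  have h := σ.k_mul s 1 t
  simp only [lab_one_left, lab_one_right, map_one, one_mul, mul_one] at h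
  exact mul_eq_right.mp h

/-- Sticks exist. -/
instance : Nonempty X.Stick := by
  classical
  let o : X.Coker → X.Gr := fun s => if s = 1 then 𝟙_ X.Gr else ⟨Quotient.out s⟩
  have ho : ∀ s, (o s).cls = s := by
    intro s
    by_cases h : s = 1
    · simp [o, h]
    · simp only [o, h, if_false, Gr.cls]
      exact Quotient.out_eq s
  let i : ∀ x : X.Gr, o x.cls ≅ x := fun x =>
    if h : o x.cls = x then eqToIso h else ((Gr.cls_eq_iff _ _).mp (ho x.cls)).some
  have hi : ∀ x : X.Gr, o x.cls = x → (i x).hom.label = 1 := by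
    intro x h
    simp [i, h]
  refine ⟨⟨o, ho, i, by simp [o], fun s => ?_, fun s => ?_, fun s => ?_⟩⟩
  · ext
    rw [Gr.label_eqToHom, hi _ (by rw [ho])]
  · ext
    rw [hi _ ?_, Gr.label_comp, Gr.label_eqToHom, Gr.label_inv, Gr.label_leftUnitor_hom]
    · simp
    · rw [Gr.cls_tensor, Gr.cls_unit, one_mul, ho]
      exact Gr.ext (one_mul _).symm
  · ext
    rw [hi _ ?_, Gr.label_comp, Gr.label_eqToHom, Gr.label_inv, Gr.label_rightUnitor_hom]
    · simp
    · rw [Gr.cls_tensor, Gr.cls_unit, mul_one, ho]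
      exact Gr.ext (mul_one _).symm

/-- The objects of the reduced Gr-category `S_ℙ` with respect to `σ`: the elements of `Coker d`. -/
@[ext]
structure Red (σ : X.Stick) where
  /-- the underlying element of `Coker d` -/
  val : X.Coker

namespace Red

variable {σ}

/-- The morphisms of `S_ℙ`: only automorphisms `(s, u) : s ⟶ s` with `u ∈ Ker d`. -/
@[ext]
structure Hom (s t : σ.Red) where
  /-- the element of `Ker d` -/
  label : X.d.ker
  eq : s = t

/-- Composition is the operation of `Ker d`. -/
instance : Groupoid σ.Red where
  Hom := Hom
  id _ := ⟨1, rfl⟩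
  comp f g := ⟨f.label * g.label, f.eq.trans g.eq⟩
  inv f := ⟨f.label⁻¹, f.eq.symm⟩
  id_comp _ := Hom.ext (one_mul _)
  comp_id _ := Hom.ext (mul_one _)
  assoc _ _ _ := Hom.ext (mul_assoc _ _ _)
  inv_comp _ := Hom.ext (inv_mul_cancel _)
  comp_inv _ := Hom.ext (mul_inv_cancel _)

@[ext]
theorem hom_ext {s t : σ.Red} {f g : s ⟶ t} (h : f.label = g.label) : f = g := Hom.ext h

@[simp] theorem label_id (s : σ.Red) : Hom.label (𝟙 s) = 1 := rfl

@[simp] theorem label_comp {s t r : σ.Red} (f : s ⟶ t) (g : t ⟶ r) :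
    (f ≫ g).label = f.label * g.label := rfl

/-- The isomorphism with a given label. -/
def mkIso {s t : σ.Red} (u : X.d.ker) (h : s = t) : s ≅ t where
  hom := ⟨u, h⟩
  inv := ⟨u⁻¹, h.symm⟩
  hom_inv_id := Hom.ext (mul_inv_cancel _)
  inv_hom_id := Hom.ext (inv_mul_cancel _)

/-- The tensor product `s ⊗ t = st`, `(s, u) ⊗ (t, v) = (st, u + s v)`; the unit constraints are
strict and the associativity constraint `s ⊗ (r ⊗ t) ⟶ (s ⊗ r) ⊗ t` is `(srt, k(s,r,t))`. -/
noncomputable instance : MonoidalCategoryStruct σ.Red where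
  tensorObj s t := ⟨s.val * t.val⟩
  tensorUnit := ⟨1⟩
  tensorHom {s _ t _} f g := ⟨f.label * X.act s.val g.label, by rw [f.eq, g.eq]⟩
  whiskerLeft s _ _ g := ⟨X.act s.val g.label, by rw [g.eq]⟩
  whiskerRight f t := ⟨f.label, by rw [f.eq]⟩
  associator s r t := (mkIso (σ.k s.val r.val t.val)
    (Stick.Red.ext (mul_assoc s.val r.val t.val).symm)).symm
  leftUnitor s := mkIso 1 (Stick.Red.ext (one_mul s.val))
  rightUnitor s := mkIso 1 (Stick.Red.ext (mul_one s.val))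

@[simp] theorem val_tensor (s t : σ.Red) : (s ⊗ t).val = s.val * t.val := rfl

@[simp] theorem val_unit : (𝟙_ σ.Red).val = 1 := rfl

@[simp] theorem label_tensorHom {x y x' y' : σ.Red} (f : x ⟶ y) (g : x' ⟶ y') :
    (f ⊗ₘ g).label = f.label * X.act x.val g.label := rfl

@[simp] theorem label_whiskerLeft (x : σ.Red) {y z : σ.Red} (f : y ⟶ z) :
    (x ◁ f).label = X.act x.val f.label := rfl

@[simp] theorem label_whiskerRight {x y : σ.Red} (f : x ⟶ y) (z : σ.Red) :
    (f ▷ z).label = f.label := rfl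

@[simp] theorem label_associator_inv (s r t : σ.Red) :
    (α_ s r t).inv.label = σ.k s.val r.val t.val := rfl

@[simp] theorem label_associator_hom (s r t : σ.Red) :
    (α_ s r t).hom.label = (σ.k s.val r.val t.val)⁻¹ := rfl

@[simp] theorem label_leftUnitor_hom (s : σ.Red) : (λ_ s).hom.label = 1 := rfl

@[simp] theorem label_rightUnitor_hom (s : σ.Red) : (ρ_ s).hom.label = 1 := rfl

/-- The reduced Gr-category `S_ℙ = (Coker d, Ker d, k)`. -/
noncomputable instance : MonoidalCategory σ.Red where
  tensorHom_def {s t s' t'} f g := by obtain rfl := f.eq; ext; simp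
  id_tensorHom_id x y := by ext; simp
  tensorHom_comp_tensorHom {x₁ y₁ z₁ x₂ y₂ z₂} f₁ f₂ g₁ g₂ := by
    obtain rfl := f₁.eq
    ext
    simp [mul_mul_mul_comm]
  whiskerLeft_id x y := by ext; simp
  id_whiskerRight x y := by ext; simp
  associator_naturality {x₁ x₂ x₃ y₁ y₂ y₃} f₁ f₂ f₃ := by
    obtain rfl := f₁.eq
    obtain rfl := f₂.eq
    obtain rfl := f₃.eq
    ext
    simp [X.act_mul, mul_assoc, mul_comm, mul_left_comm]
  leftUnitor_naturality f := by ext; simp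
  rightUnitor_naturality f := by ext; simp
  pentagon s r t v := by
    have h := σ.k_cocycle s.val r.val t.val v.val
    apply hom_ext
    simp only [label_comp, label_whiskerLeft, label_whiskerRight, label_associator_hom,
      val_tensor, act_map_inv, ← mul_inv, inv_inj]
    rw [← h, mul_comm, mul_comm (σ.k _ _ _)]
  triangle s t := by ext; simp [σ.k_one_mid]

/-- The canonical functor `H : S_ℙ ⥤ ℙ`, `H(s) = x_s`, `H(s, u) = γ_{x_s}(u)`. -/
def canonical (σ : X.Stick) : σ.Red ⥤ X.Gr where
  obj s := σ.obj s.val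
  map {s t} f := Gr.gamma (σ.obj s.val) f.label ≫ eqToHom (by rw [f.eq])
  map_id s := by ext; simp
  map_comp f g := by ext; simp

@[simp] theorem label_canonical_map {s t : σ.Red} (f : s ⟶ t) :
    ((canonical σ).map f).label = f.label.1 := by
  simp [canonical]

instance : (canonical σ).IsEquivalence where
  faithful := ⟨fun {s t f g} h => by
    have := congrArg Gr.Hom.label h
    simp only [label_canonical_map] at this
    exact hom_ext (Subtype.ext this)⟩
  full := ⟨fun {s t} f => by
    have h : s = t := by
      have h := (Gr.cls_eq_iff _ _).mpr ⟨(Groupoid.isoEquivHom _ _).symm f⟩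
      simp only [canonical, σ.cls_obj] at h
      exact Stick.Red.ext h
    subst h
    obtain ⟨u, hu⟩ := (Gr.gamma_bijective _).2 f
    exact ⟨⟨u, rfl⟩, by ext; simp [← hu]⟩⟩
  essSurj := ⟨fun x => ⟨⟨x.cls⟩, ⟨σ.iso x⟩⟩⟩

/-- `H` with the constraints `i_{x_s ⊗ x_t}⁻¹` is a monoidal functor, so that `S_ℙ` carries the
monoidal structure transported from `ℙ`. -/
noncomputable def canonicalMonoidal (σ : X.Stick) : (canonical σ).CoreMonoidal where
  εIso := eqToIso σ.obj_one.symm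
  μIso s t := (σ.mu s.val t.val).symm
  μIso_hom_natural_left {s t} f r := by
    obtain rfl := f.eq
    ext
    simp [canonical]
    exact X.comm_of_mem_ker f.label.2 _
  μIso_hom_natural_right {s t} r f := by
    obtain rfl := f.eq
    ext
    simp [canonical]
    rw [← σ.act_eq]
    exact X.comm_of_mem_ker (X.act r.val f.label).2 _
  associativity s r t := by
    ext
    simp [canonical]
    have h := congrArg (fun b => b⁻¹) (σ.k_mul s.val r.val t.val)
    simp only [mul_inv_rev, lab] at h
    rw [← mul_assoc, h]
  left_unitality s := by
    ext
    simp [canonical]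
    exact σ.lab_one_left s.val
  right_unitality s := by
    ext
    simp [canonical]
    exact σ.lab_one_right s.val

end Red

end Stick

/-- `k` as an inhomogeneous 3-cocycle of `Coker d` with coefficients in `Ker d`. -/
noncomputable def Stick.cocycle {X : CrossedModule B D} (σ : X.Stick) :
    groupCohomology.cocycles X.kerRep 3 :=
  groupCohomology.cocyclesMk
    (fun g => (Additive.ofMul (σ.k (g 0) (g 1) (g 2)) : Additive X.d.ker)) (by
    funext g
    have h : X.cokerAct (g 0) (Additive.ofMul (σ.k (g 1) (g 2) (g 3))) +
        Additive.ofMul (σ.k (g 0) (g 1 * g 2) (g 3)) + Additive.ofMul (σ.k (g 0) (g 1) (g 2)) =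
        Additive.ofMul (σ.k (g 0 * g 1) (g 2) (g 3)) +
        Additive.ofMul (σ.k (g 0) (g 1) (g 2 * g 3)) :=
      congrArg Additive.ofMul (σ.k_cocycle (g 0) (g 1) (g 2) (g 3))
    rw [inhomogeneousCochains.d_hom_apply]
    refine (congrArg _ (Fin.sum_univ_four _)).trans ?_
    generalize h₁ : (X.cokerAct (g 0)) (Additive.ofMul (σ.k (g 1) (g 2) (g 3))) = a at h
    show (X.cokerAct (g 0)) (Additive.ofMul (σ.k (g 1) (g 2) (g 3))) + (
      (-1 : ULift.{u} ℤ) ^ 1 • Additive.ofMul (σ.k (g 0 * g 1) (g 2) (g 3)) +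
      (-1 : ULift.{u} ℤ) ^ 2 • Additive.ofMul (σ.k (g 0) (g 1 * g 2) (g 3)) +
      (-1 : ULift.{u} ℤ) ^ 3 • Additive.ofMul (σ.k (g 0) (g 1) (g 2 * g 3)) +
      (-1 : ULift.{u} ℤ) ^ 4 • Additive.ofMul (σ.k (g 0) (g 1) (g 2))) = 0
    rw [h₁, eq_sub_of_add_eq (eq_sub_of_add_eq h)]
    have e₁ : (-1 : ULift.{u} ℤ) ^ 3 = -1 := by ring
    have e₂ : (-1 : ULift.{u} ℤ) ^ 4 = 1 := by ring
    rw [e₁, e₂, pow_one, neg_one_sq]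
    simp only [neg_smul, one_smul]
    abel)

variable {Q : Type u} [Group Q]

/-- `Ker d` as a `Q`-module through `ψ : Q → Coker d`. -/
abbrev kerRes (ψ : Q →* X.Coker) : Rep.{u} (ULift.{u} ℤ) Q := Rep.res ψ X.kerRep

/-- The class of `ψ*k` in `H³_ψ(Q, Ker d)`. -/
noncomputable def obstruction {X : CrossedModule B D} (σ : X.Stick) (ψ : Q →* X.Coker) :
    groupCohomology (X.kerRes ψ) 3 :=
  groupCohomology.π (X.kerRes ψ) 3
    (groupCohomology.cocyclesMap ψ (𝟙 (X.kerRes ψ)) 3 σ.cocycle)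

/-! ### Extensions of the type of a crossed module -/

/-- For an exact sequence `1 → B → E → Q → 1`, the crossed module `(B, E, j, θ')` in which `θ'` is
given by conjugation in `E`. -/
noncomputable def ofGroupExtension {E : Type u} [Group E] (S : GroupExtension B E Q) :
    CrossedModule B E where
  d := S.inl
  θ := S.conjAct
  θ_d b := by
    ext c
    apply S.inl_injective
    simp [S.inl_conjAct_comm]
  d_θ _ _ := S.inl_conjAct_comm

/-- An extension of `B` by `Q` of type `d : B → D`. -/
structure Extension (X : CrossedModule B D) (Q : Type u) [Group Q] where
  /-- the middle group -/
  E : Type u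
  [group : Group E]
  /-- the exact sequence `1 → B → E → Q → 1` -/
  seq : GroupExtension B E Q
  /-- the homomorphism to `D` -/
  ε : E →* D
  isHom : (ofGroupExtension seq).IsHom X (MonoidHom.id B) ε

namespace Extension

attribute [instance] Extension.group

variable {X}

/-- `ℰ` induces `ψ`: `q ∘ ε = ψ ∘ p`. -/
def Induces (ℰ : X.Extension Q) (ψ : Q →* X.Coker) : Prop :=
  ∀ e : ℰ.E, (QuotientGroup.mk (ℰ.ε e) : X.Coker) = ψ (ℰ.seq.rightHom e)

/-- Equivalence of extensions of type `d : B → D`. -/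
def Equivalent (ℰ ℰ' : X.Extension Q) : Prop :=
  ∃ η : ℰ.E →* ℰ'.E, (∀ b, η (ℰ.seq.inl b) = ℰ'.seq.inl b) ∧
    (∀ e, ℰ'.seq.rightHom (η e) = ℰ.seq.rightHom e) ∧ ∀ e, ℰ'.ε (η e) = ℰ.ε e

theorem Equivalent.symm {ℰ ℰ' : X.Extension Q} (h : Equivalent ℰ ℰ') : Equivalent ℰ' ℰ := by
  obtain ⟨η, h₁, h₂, h₃⟩ := h
  let e : ℰ.seq.Equiv ℰ'.seq :=
    GroupExtension.Equiv.ofMonoidHom η (by ext; simp [h₁]) (by ext; simp [h₂])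
  have he : ∀ x, e x = η x := fun _ => rfl
  have hs : ∀ y, ∃ x, η x = y ∧ e.symm y = x := fun y =>
    ⟨e.symm y, e.toMulEquiv.apply_symm_apply y, rfl⟩
  refine ⟨e.symm.toMulEquiv.toMonoidHom, fun b => e.symm.map_inl b, fun y => e.symm.rightHom_map y,
    fun y => ?_⟩
  obtain ⟨x, rfl, hx⟩ := hs y
  rw [h₃]
  exact congrArg ℰ.ε hx

end Extension

/-- The extensions of `B` by `Q` of type `d : B → D` inducing `ψ`. -/
abbrev ExtInducing (ψ : Q →* X.Coker) : Type (u + 1) :=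
  {ℰ : X.Extension Q // ℰ.Induces ψ}

instance extSetoid (ψ : Q →* X.Coker) : Setoid (X.ExtInducing ψ) where
  r ℰ ℰ' := ℰ.1.Equivalent ℰ'.1
  iseqv :=
    { refl := fun _ => ⟨MonoidHom.id _, fun _ => rfl, fun _ => rfl, fun _ => rfl⟩
      symm := Extension.Equivalent.symm
      trans := by
        rintro _ _ _ ⟨η, h₁, h₂, h₃⟩ ⟨η', h₁', h₂', h₃'⟩
        exact ⟨η'.comp η, fun b => by simp [h₁, h₁'], fun e => by simp [h₂, h₂'],
          fun e => by simp [h₃, h₃']⟩ }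

/-- `Ext_{B → D}(Q, B, ψ)`: the equivalence classes of extensions inducing `ψ`. -/
abbrev Ext (ψ : Q →* X.Coker) : Type (u + 1) := Quotient (X.extSetoid ψ)

end CrossedModule

/-!
A section of an extension of type `B → D`, mapped to `D`, yields representatives in `D` which are
multiplicative up to factors in `B`, and the associativity of the extension is a cocycle identity
for these factors. Conversely, factors satisfying this identity define a crossed product extension,
and changes of section correspond to equivalences. A stick provides representatives and factors over
`ψ` whose deviation from the cocycle identity is exactly `ψ*k`. The other factors with the same
representatives differ from these by a cochain `u : Q² → Ker d`, and their deviation vanishes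
precisely when `u` cobounds `ψ*k`; so an extension exists precisely when `ψ*k` is a coboundary.
Starting instead from the factors of an extension, the cochains `u` which preserve the cocycle
identity are the 2-cocycles, and two of them give equivalent extensions precisely when they are
cohomologous.
-/

section Homology

theorem homologyπ_eq_zero_iff {R ι : Type*} [Ring R] {c : ComplexShape ι}
    (K : HomologicalComplex (ModuleCat R) c) {i j : ι} (hij : c.prev j = i) (z : K.cycles j) :
    K.homologyπ j z = 0 ↔ ∃ x, K.d i j x = K.iCycles j z := by
  have exact_toCycles := ShortComplex.exact_of_g_is_cokernel
    (ShortComplex.mk _ _ (K.toCycles_comp_homologyπ i j)) (K.homologyIsCokernel i j hij)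
  have toCycles_eq_iff (x : K.X i) : K.toCycles i j x = z ↔ K.d i j x = K.iCycles j z := by
    rw [← K.toCycles_i, ConcreteCategory.comp_apply,
      ((ModuleCat.mono_iff_injective (K.iCycles j)).mp inferInstance).eq_iff]
  simp only [← toCycles_eq_iff]
  refine ⟨(ShortComplex.moduleCat_exact_iff _).mp exact_toCycles z, ?_⟩
  rintro ⟨x, rfl⟩
  exact ConcreteCategory.congr_hom (K.toCycles_comp_homologyπ i j) x

open groupCohomology in
theorem groupCohomology_π_three_eq_zero_iff {k G : Type u} [CommRing k] [Group G] (A : Rep.{u} k G)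
    (z : cocycles A 3) :
    π A 3 z = 0 ↔ ∃ u, d₂₃ A u = (cochainsIso₃ A).hom (iCocycles A 3 z) := by
  refine (homologyπ_eq_zero_iff _ (i := 2) (by simp) z).trans ?_
  refine (cochainsIso₂ A).toLinearEquiv.toEquiv.exists_congr fun u => ?_
  have d₂₃_hom : d₂₃ A ((cochainsIso₂ A).hom u) =
      (cochainsIso₃ A).hom ((inhomogeneousCochains A).d 2 3 u) := by
    rw [← ConcreteCategory.comp_apply, comp_d₂₃_eq, ConcreteCategory.comp_apply]
  exact (cochainsIso₃ A).toLinearEquiv.injective.eq_iff.symm.trans (Eq.congr_left d₂₃_hom.symm)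

open groupCohomology in
theorem groupCohomology_H2π_surjective {k G : Type u} [CommRing k] [Group G] (A : Rep.{u} k G) :
    Function.Surjective (H2π A) :=
  (ModuleCat.epi_iff_surjective _).mp inferInstance

end Homology

/-! ### Factor sets and crossed products -/

namespace CrossedModule

section FactorSet

variable {B D Q : Type*} [Group B] [Group D] [Group Q]

/-- A choice of representatives in `D`, multiplicative up to factors in `B`. No normalization is
imposed at `1 : Q`. -/
@[ext]
structure PreFactorSet (X : CrossedModule B D) (Q : Type*) [Group Q] where
  /-- the representatives in `D` -/
  rep : Q → D
  /-- the factors in `B` -/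
  factor : Q → Q → B
  rep_mul_rep : ∀ p q, rep p * rep q = X.d (factor p q) * rep (p * q)

variable {X : CrossedModule B D}

namespace PreFactorSet

/-- Schreier's non-abelian cocycle identity for the factors. -/
def IsCocycle (P : PreFactorSet X Q) : Prop :=
  ∀ p q r, P.factor p q * P.factor (p * q) r =
    X.θ (P.rep p) (P.factor q r) * P.factor p (q * r)

/-- Two families of representatives and factors are cohomologous when they differ by a change
`e q ↦ h q * e q` of the section `e` which they describe. -/
def Cohomologous (P P' : PreFactorSet X Q) : Prop :=
  ∃ h : Q → B, (∀ q, P.rep q = X.d (h q) * P'.rep q) ∧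
    ∀ p q, P.factor p q * h (p * q) = h p * X.θ (P'.rep p) (h q) * P'.factor p q

end PreFactorSet

theorem θ_d_mul_apply (X : CrossedModule B D) (b c : B) (x : D) :
    X.θ (X.d b * x) c = b * X.θ x c * b⁻¹ := by
  rw [map_mul, X.θ_d, MulAut.mul_apply, MulAut.conj_apply]

/-- A factor set of type `X`, describing a group extension of `B` by `Q` together with a section
and a homomorphism to `D`. -/
structure FactorSet (X : CrossedModule B D) (Q : Type*) [Group Q] extends PreFactorSet X Q where
  isCocycle : toPreFactorSet.IsCocycle

namespace FactorSet

variable (F : FactorSet X Q)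

theorem θ_rep_θ_rep (p q : Q) (b : B) :
    X.θ (F.rep p) (X.θ (F.rep q) b) =
      F.factor p q * X.θ (F.rep (p * q)) b * (F.factor p q)⁻¹ := by
  rw [← MulAut.mul_apply, ← map_mul, F.rep_mul_rep, θ_d_mul_apply]

theorem rep_one : F.rep 1 = X.d (F.factor 1 1) := by
  have h := F.rep_mul_rep 1 1
  rwa [mul_one, mul_left_inj] at h

theorem θ_rep_one (b : B) : X.θ (F.rep 1) b = F.factor 1 1 * b * (F.factor 1 1)⁻¹ := by
  rw [F.rep_one, X.θ_d, MulAut.conj_apply]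

theorem factor_one_left (q : Q) : F.factor 1 q = F.factor 1 1 := by
  have h := F.isCocycle 1 1 q
  rw [one_mul, one_mul, mul_left_inj, θ_rep_one, eq_mul_inv_iff_mul_eq, mul_right_inj] at h
  exact h.symm

theorem factor_one_right (p : Q) : F.factor p 1 = X.θ (F.rep p) (F.factor 1 1) := by
  have h := F.isCocycle p 1 1
  rwa [mul_one, mul_one, mul_left_inj] at h

/-- The crossed product of `B` and `Q` along a factor set: the group of pairs `(b, q)`, standing
for `b * e q` where `e` is the section described by the factor set. -/
@[ext]
structure CrossedProduct (F : FactorSet X Q) where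
  /-- the component in `B` -/
  left : B
  /-- the component in `Q` -/
  right : Q

namespace CrossedProduct

variable {F}

instance : Mul F.CrossedProduct where
  mul a b := ⟨a.left * X.θ (F.rep a.right) b.left * F.factor a.right b.right, a.right * b.right⟩

-- The factor set is not normalized, so that the section takes the value `F.factor 1 1` at `1`.
instance : One F.CrossedProduct where
  one := ⟨(F.factor 1 1)⁻¹, 1⟩

instance : Inv F.CrossedProduct where
  inv a := ⟨(F.factor 1 1)⁻¹ * (X.θ (F.rep a.right⁻¹) a.left * F.factor a.right⁻¹ a.right)⁻¹,
    a.right⁻¹⟩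

@[simp] theorem left_mul (a b : F.CrossedProduct) : (a * b).left =
    a.left * X.θ (F.rep a.right) b.left * F.factor a.right b.right := rfl

@[simp] theorem right_mul (a b : F.CrossedProduct) : (a * b).right = a.right * b.right := rfl

@[simp] theorem left_one : (1 : F.CrossedProduct).left = (F.factor 1 1)⁻¹ := rfl

@[simp] theorem right_one : (1 : F.CrossedProduct).right = 1 := rfl

@[simp] theorem left_inv (a : F.CrossedProduct) : (a⁻¹).left =
    (F.factor 1 1)⁻¹ * (X.θ (F.rep a.right⁻¹) a.left * F.factor a.right⁻¹ a.right)⁻¹ := rfl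

@[simp] theorem right_inv (a : F.CrossedProduct) : (a⁻¹).right = a.right⁻¹ := rfl

protected theorem mul_assoc (a b c : F.CrossedProduct) : a * b * c = a * (b * c) := by
  ext
  · have h := mul_inv_eq_of_eq_mul (F.isCocycle a.right b.right c.right)
    simp only [left_mul, right_mul, map_mul, F.θ_rep_θ_rep, mul_assoc] at h ⊢
    simp only [← h, inv_mul_cancel_left, inv_mul_cancel, mul_one, mul_assoc]
  · exact mul_assoc _ _ _

protected theorem one_mul (a : F.CrossedProduct) : 1 * a = a := by
  ext
  · simp only [left_mul, left_one, right_one, F.θ_rep_one, F.factor_one_left]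
    group
  · exact one_mul _

protected theorem inv_mul_cancel (a : F.CrossedProduct) : a⁻¹ * a = 1 := by
  ext
  · simp only [left_mul, left_inv, right_inv, left_one]
    group
  · exact inv_mul_cancel _

instance : Group F.CrossedProduct :=
  Group.ofLeftAxioms CrossedProduct.mul_assoc CrossedProduct.one_mul CrossedProduct.inv_mul_cancel

end CrossedProduct

/-- The section `e` of the crossed product described by the factor set. -/
@[simps]
def lift (q : Q) : F.CrossedProduct := ⟨1, q⟩

/-- The inclusion of `B` in the crossed product. -/
@[simps]
def inl : B →* F.CrossedProduct where
  toFun b := ⟨b * (F.factor 1 1)⁻¹, 1⟩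
  map_one' := CrossedProduct.ext (one_mul _) rfl
  map_mul' b c := by
    ext
    · simp only [CrossedProduct.left_mul, F.θ_rep_one]
      group
    · exact (one_mul _).symm

theorem inl_mul (b : B) (a : F.CrossedProduct) : F.inl b * a = ⟨b * a.left, a.right⟩ := by
  ext
  · simp only [CrossedProduct.left_mul, inl_apply_left, inl_apply_right, F.θ_rep_one,
      F.factor_one_left a.right]
    group
  · exact one_mul _

theorem inl_mul_lift (b : B) (q : Q) : F.inl b * F.lift q = ⟨b, q⟩ := by
  rw [inl_mul, lift_left, mul_one, lift_right]

theorem lift_mul_lift (p q : Q) :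
    F.lift p * F.lift q = F.inl (F.factor p q) * F.lift (p * q) := by
  rw [inl_mul_lift]
  ext <;> simp

theorem lift_mul_inl (q : Q) (b : B) :
    F.lift q * F.inl b = F.inl (X.θ (F.rep q) b) * F.lift q := by
  rw [inl_mul_lift]
  ext
  · rw [CrossedProduct.left_mul, lift_left, lift_right, inl_apply_left, inl_apply_right, one_mul,
      F.factor_one_right q, ← map_mul, inv_mul_cancel_right]
  · exact mul_one _

/-- The short exact sequence `1 → B → F.CrossedProduct → Q → 1`. -/
def groupExtension : GroupExtension B F.CrossedProduct Q where
  inl := F.inl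
  rightHom :=
    { toFun := CrossedProduct.right
      map_one' := rfl
      map_mul' := fun _ _ => rfl }
  inl_injective _ _ h := mul_right_cancel (congrArg CrossedProduct.left h)
  range_inl_eq_ker_rightHom := by
    ext a
    constructor
    · rintro ⟨b, rfl⟩
      rfl
    · intro h
      exact ⟨a.left * F.factor 1 1,
        CrossedProduct.ext (mul_inv_cancel_right _ _) (MonoidHom.mem_ker.mp h).symm⟩
  rightHom_surjective q := ⟨F.lift q, rfl⟩

/-- The homomorphism `b * e q ↦ d b * rep q` from the crossed product to `D`. -/
@[simps]
def toBase : F.CrossedProduct →* D where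
  toFun a := X.d a.left * F.rep a.right
  map_one' := by simp [F.rep_one]
  map_mul' a b := by
    simp only [CrossedProduct.left_mul, CrossedProduct.right_mul, map_mul, X.d_θ, mul_assoc,
      ← F.rep_mul_rep, inv_mul_cancel_left]

theorem toBase_inl (b : B) : F.toBase (F.inl b) = X.d b := by
  simp [F.rep_one]

theorem mul_inl (a : F.CrossedProduct) (b : B) :
    a * F.inl b = F.inl (X.θ (F.toBase a) b) * a := by
  obtain ⟨c, q⟩ := a
  rw [← inl_mul_lift, mul_assoc, lift_mul_inl, ← mul_assoc, ← mul_assoc, ← map_mul, ← map_mul]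
  simp only [inl_mul_lift, toBase_apply, θ_d_mul_apply, inv_mul_cancel_right]

section Cohomologous

variable {F} {F' : FactorSet X Q}

/-- A change of section `e q = h q * e' q` as a homomorphism of crossed products. -/
def mapOfCohomologous (h : Q → B) (hrep : ∀ q, F.rep q = X.d (h q) * F'.rep q)
    (hfactor : ∀ p q, F.factor p q * h (p * q) =
      h p * X.θ (F'.rep p) (h q) * F'.factor p q) :
    F.CrossedProduct →* F'.CrossedProduct :=
  MonoidHom.mk' (fun a => ⟨a.left * h a.right, a.right⟩) fun a b => by
    ext
    · simp only [CrossedProduct.left_mul, CrossedProduct.right_mul, mul_assoc, hfactor, hrep,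
        θ_d_mul_apply]
      simp only [map_mul, mul_assoc, inv_mul_cancel_left]
    · rfl

end Cohomologous

end FactorSet

end FactorSet

/-! ### Extensions and factor sets -/

variable {B D Q : Type u} [Group B] [Group D] [Group Q] {X : CrossedModule B D}

theorem mk_d_mul (b : B) (x : D) :
    (QuotientGroup.mk (X.d b * x) : X.Coker) = QuotientGroup.mk x := by
  have mk_d : (QuotientGroup.mk (X.d b) : X.Coker) = 1 := (QuotientGroup.eq_one_iff _).mpr ⟨b, rfl⟩
  rw [QuotientGroup.mk_mul, mk_d, one_mul]

/-- The representatives lie over `ψ`. -/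
def PreFactorSet.Induces (P : PreFactorSet X Q) (ψ : Q →* X.Coker) : Prop :=
  ∀ q, (QuotientGroup.mk (P.rep q) : X.Coker) = ψ q

namespace FactorSet

/-- The crossed product as an extension of type `X`. -/
def extension (F : FactorSet X Q) : X.Extension Q where
  E := F.CrossedProduct
  seq := F.groupExtension
  ε := F.toBase
  isHom :=
    { comm := F.toBase_inl
      equivariant := fun a b => F.groupExtension.inl_injective <|
        F.groupExtension.inl_conjAct_comm.trans (mul_inv_eq_of_eq_mul (F.mul_inl a b)) }

theorem extension_induces {F : FactorSet X Q} {ψ : Q →* X.Coker} (hF : F.Induces ψ) :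
    F.extension.Induces ψ :=
  fun a => (mk_d_mul a.left (F.rep a.right)).trans (hF a.right)

theorem extension_equivalent_iff {F F' : FactorSet X Q} :
    F.extension.Equivalent F'.extension ↔ F.Cohomologous F'.toPreFactorSet := by
  constructor
  · rintro ⟨η, hinl, hright, hε⟩
    change F.CrossedProduct →* F'.CrossedProduct at η
    have right_lift (q : Q) : (η (F.lift q)).right = q := hright (F.lift q)
    refine ⟨fun q => (η (F.lift q)).left, fun q => ?_, fun p q => ?_⟩
    · have h : F'.toBase (η (F.lift q)) = F.toBase (F.lift q) := hε (F.lift q)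
      simpa only [toBase_apply, right_lift, lift_left, lift_right, map_one, one_mul] using h.symm
    · have h : η (F.lift p) * η (F.lift q) = F'.inl (F.factor p q) * η (F.lift (p * q)) := by
        rw [← map_mul, lift_mul_lift, map_mul]
        exact congrArg (· * _) (hinl _)
      simpa only [CrossedProduct.left_mul, inl_mul, right_lift] using
        (congrArg CrossedProduct.left h).symm
  · rintro ⟨h, hrep, hfactor⟩
    have factor_one_one : F.factor 1 1 = h 1 * F'.factor 1 1 := by
      have := hfactor 1 1
      rwa [mul_one, F'.θ_rep_one, ← mul_assoc, ← mul_assoc, inv_mul_cancel_right,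
        mul_left_inj] at this
    refine ⟨mapOfCohomologous h hrep hfactor, fun b => CrossedProduct.ext ?_ rfl, fun _ => rfl,
      fun a => ?_⟩
    · change b * (F.factor 1 1)⁻¹ * h 1 = b * (F'.factor 1 1)⁻¹
      rw [factor_one_one, mul_inv_rev, mul_assoc, inv_mul_cancel_right]
    · change X.d (a.left * h a.right) * F'.rep a.right = X.d a.left * F.rep a.right
      rw [hrep, map_mul, mul_assoc]

end FactorSet

namespace Extension

variable (ℰ : X.Extension Q) {ψ : Q →* X.Coker}

theorem ε_inl (b : B) : ℰ.ε (ℰ.seq.inl b) = X.d b := ℰ.isHom.comm b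

theorem mul_inl (e : ℰ.E) (b : B) :
    e * ℰ.seq.inl b = ℰ.seq.inl (X.θ (ℰ.ε e) b) * e := by
  rw [← mul_inv_eq_iff_eq_mul, ← ℰ.seq.inl_conjAct_comm]
  exact congrArg _ (ℰ.isHom.equivariant e b)

variable {ℰ}

/-- The factor of a section at `(p, q)`. -/
noncomputable def sectionFactor (s : ℰ.seq.Section) (p q : Q) : B :=
  (s.mul_mul_mul_inv_mem_range_inl p q).choose

theorem section_mul_section (s : ℰ.seq.Section) (p q : Q) :
    s p * s q = ℰ.seq.inl (sectionFactor s p q) * s (p * q) :=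
  (mul_inv_eq_iff_eq_mul.mp (s.mul_mul_mul_inv_mem_range_inl p q).choose_spec.symm)

theorem section_one (s : ℰ.seq.Section) : s 1 = ℰ.seq.inl (sectionFactor s 1 1) := by
  have h := section_mul_section s 1 1
  rwa [mul_one, mul_left_inj] at h

theorem inl_mul_section_mul (s : ℰ.seq.Section) (b c : B) (p q : Q) :
    ℰ.seq.inl b * s p * (ℰ.seq.inl c * s q) =
      ℰ.seq.inl (b * X.θ (ℰ.ε (s p)) c * sectionFactor s p q) * s (p * q) := by
  rw [mul_assoc, ← mul_assoc (s p), ℰ.mul_inl, mul_assoc _ (s p), section_mul_section]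
  simp only [map_mul, mul_assoc]

theorem sectionFactor_mul_sectionFactor (s : ℰ.seq.Section) (p q r : Q) :
    sectionFactor s p q * sectionFactor s (p * q) r =
      X.θ (ℰ.ε (s p)) (sectionFactor s q r) * sectionFactor s p (q * r) := by
  apply ℰ.seq.inl_injective
  apply mul_right_cancel (b := s (p * q * r))
  calc ℰ.seq.inl (sectionFactor s p q * sectionFactor s (p * q) r) * s (p * q * r)
      = s p * s q * s r := by
        rw [map_mul, mul_assoc, ← section_mul_section, ← mul_assoc, ← section_mul_section]
    _ = s p * ℰ.seq.inl (sectionFactor s q r) * s (q * r) := by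
        rw [mul_assoc, section_mul_section, mul_assoc]
    _ = ℰ.seq.inl (X.θ (ℰ.ε (s p)) (sectionFactor s q r) * sectionFactor s p (q * r)) *
          s (p * q * r) := by
        rw [ℰ.mul_inl, mul_assoc, section_mul_section s p, map_mul ℰ.seq.inl, mul_assoc,
          mul_assoc p]

/-- The factor set of a section of an extension. -/
noncomputable def factorSet (s : ℰ.seq.Section) : FactorSet X Q where
  rep q := ℰ.ε (s q)
  factor := sectionFactor s
  rep_mul_rep p q := by rw [← map_mul, section_mul_section, map_mul, ℰ.ε_inl]
  isCocycle := sectionFactor_mul_sectionFactor s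

theorem factorSet_extension_equivalent (s : ℰ.seq.Section) :
    (factorSet s).extension.Equivalent ℰ := by
  refine ⟨MonoidHom.mk' (fun a : (factorSet s).CrossedProduct => ℰ.seq.inl a.left * s a.right)
    fun a b => (inl_mul_section_mul s a.left b.left a.right b.right).symm,
    fun b => ?_, fun a => ?_, fun a => ?_⟩
  · change ℰ.seq.inl (b * (sectionFactor s 1 1)⁻¹) * s 1 = _
    rw [section_one, ← map_mul, inv_mul_cancel_right]
  · change ℰ.seq.rightHom (ℰ.seq.inl a.left * s a.right) = a.right
    rw [map_mul, ℰ.seq.rightHom_inl, one_mul, s.rightHom_section]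
  · change ℰ.ε (ℰ.seq.inl a.left * s a.right) = X.d a.left * ℰ.ε (s a.right)
    rw [map_mul, ℰ.ε_inl]

theorem Induces.factorSet (hℰ : ℰ.Induces ψ) (s : ℰ.seq.Section) :
    (factorSet s).Induces ψ := fun q =>
  (hℰ (s q)).trans (congrArg ψ (s.rightHom_section q))

theorem Induces.exists_section (hℰ : ℰ.Induces ψ) {P : PreFactorSet X Q} (hP : P.Induces ψ) :
    ∃ s : ℰ.seq.Section, ∀ q, ℰ.ε (s q) = P.rep q := by
  have exists_lift (q : Q) : ∃ e, ℰ.seq.rightHom e = q ∧ ℰ.ε e = P.rep q := by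
    obtain ⟨e, rfl⟩ := ℰ.seq.rightHom_surjective q
    obtain ⟨b, hb⟩ := QuotientGroup.eq.mp ((hℰ e).trans (hP _).symm)
    exact ⟨e * ℰ.seq.inl b, by simp, by rw [map_mul, ℰ.ε_inl, hb, mul_inv_cancel_left]⟩
  choose s hright hε using exists_lift
  exact ⟨⟨s, hright⟩, hε⟩

end Extension

/-! ### Twisting by cochains with values in `Ker d` -/

section Twist

open groupCohomology

variable {ψ : Q →* X.Coker}

/-- The inclusion of the `Q`-module `Ker d` in `B`, turning addition into multiplication. -/
def kerIncl (a : X.kerRes ψ) : B :=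
  (Additive.toMul (show Additive X.d.ker from a)).1

theorem kerIncl_injective : Function.Injective (kerIncl : X.kerRes ψ → B) :=
  Subtype.val_injective

theorem kerIncl_add (a b : X.kerRes ψ) : kerIncl (a + b) = kerIncl a * kerIncl b := rfl

theorem d_kerIncl (a : X.kerRes ψ) : X.d (kerIncl a) = 1 :=
  (Additive.toMul (show Additive X.d.ker from a)).2

theorem commute_kerIncl (a : X.kerRes ψ) (b : B) : Commute (kerIncl a) b :=
  X.comm_of_mem_ker (d_kerIncl a) b

theorem exists_kerIncl_eq (ψ : Q →* X.Coker) {b : B} (hb : X.d b = 1) :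
    ∃ a : X.kerRes ψ, kerIncl a = b :=
  ⟨(Additive.ofMul ⟨b, hb⟩ : Additive X.d.ker), rfl⟩

theorem kerIncl_ρ {x : D} {q : Q} (hx : (QuotientGroup.mk x : X.Coker) = ψ q) (a : X.kerRes ψ) :
    kerIncl ((X.kerRes ψ).ρ q a) = X.θ x (kerIncl a) := by
  change (X.act (ψ q) _).1 = _
  rw [← hx]
  rfl

namespace PreFactorSet

variable (P : PreFactorSet X Q)

/-- Multiplication of the factors by a cochain with values in `Ker d`. -/
@[simps]
def twist (u : Q × Q → X.kerRes ψ) : PreFactorSet X Q where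
  rep := P.rep
  factor p q := P.factor p q * kerIncl (u (p, q))
  rep_mul_rep p q := by rw [map_mul, d_kerIncl, mul_one, P.rep_mul_rep]

/-- The Eilenberg–Mac Lane obstruction cochain: `k` measures the failure of the cocycle
identity. -/
def HasObstruction (k : Q × Q × Q → X.kerRes ψ) : Prop :=
  ∀ p q r, P.factor p q * P.factor (p * q) r =
    X.θ (P.rep p) (P.factor q r) * P.factor p (q * r) * kerIncl (k (p, q, r))

variable {P}

theorem exists_eq_twist (ψ : Q →* X.Coker) {P' : PreFactorSet X Q} (h : P'.rep = P.rep) :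
    ∃ u : Q × Q → X.kerRes ψ, P' = P.twist u := by
  have d_inv_mul (p q : Q) : X.d ((P.factor p q)⁻¹ * P'.factor p q) = 1 := by
    have hd := (P'.rep_mul_rep p q).symm
    rw [h, P.rep_mul_rep, mul_left_inj] at hd
    rw [map_mul, map_inv, hd, inv_mul_cancel]
  choose u hu using fun p q => exists_kerIncl_eq ψ (d_inv_mul p q)
  refine ⟨fun g => u g.1 g.2, PreFactorSet.ext h ?_⟩
  funext p q
  rw [twist_factor, hu, mul_inv_cancel_left]

theorem HasObstruction.twist_isCocycle_iff {k : Q × Q × Q → X.kerRes ψ} (hk : P.HasObstruction k)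
    (hP : P.Induces ψ) (u : Q × Q → X.kerRes ψ) :
    (P.twist u).IsCocycle ↔ d₂₃ (X.kerRes ψ) u = k := by
  simp only [IsCocycle, funext_iff, Prod.forall]
  refine forall_congr' fun p => forall_congr' fun q => forall_congr' fun r => ?_
  have hl : (P.twist u).factor p q * (P.twist u).factor (p * q) r =
      X.θ (P.rep p) (P.factor q r) * P.factor p (q * r) *
        kerIncl (k (p, q, r) + (u (p, q) + u (p * q, r))) := by
    rw [twist_factor, twist_factor, (commute_kerIncl _ _).mul_mul_mul_comm, hk, mul_assoc,
      kerIncl_add, kerIncl_add]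
  have hr : X.θ (P.rep p) ((P.twist u).factor q r) * (P.twist u).factor p (q * r) =
      X.θ (P.rep p) (P.factor q r) * P.factor p (q * r) *
        kerIncl ((X.kerRes ψ).ρ p (u (q, r)) + u (p, q * r)) := by
    rw [twist_factor, twist_factor, map_mul, ← kerIncl_ρ (hP p),
      (commute_kerIncl _ _).mul_mul_mul_comm, kerIncl_add]
  rw [hl, twist_rep, hr, mul_right_inj, kerIncl_injective.eq_iff, d₂₃_hom_apply]
  refine eq_comm.trans (sub_eq_iff_eq_add.symm.trans (Eq.congr_left ?_))
  change (X.kerRes ψ).ρ p (u (q, r)) + _ - _ = (X.kerRes ψ).ρ p (u (q, r)) - _ + _ - _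
  abel

theorem twist_factor_mul_kerIncl_iff (hP : P.Induces ψ) (u u' : Q × Q → X.kerRes ψ)
    (a : Q → X.kerRes ψ) (p q : Q) :
    (P.twist u).factor p q * kerIncl (a (p * q)) =
        kerIncl (a p) * X.θ (P.rep p) (kerIncl (a q)) * (P.twist u').factor p q ↔
      d₁₂ (X.kerRes ψ) a (p, q) = u (p, q) - u' (p, q) := by
  have hl : (P.twist u).factor p q * kerIncl (a (p * q)) =
      P.factor p q * kerIncl (u (p, q) + a (p * q)) := by
    rw [twist_factor, mul_assoc, kerIncl_add]
  have hr : kerIncl (a p) * X.θ (P.rep p) (kerIncl (a q)) * (P.twist u').factor p q =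
      P.factor p q * kerIncl (a p + (X.kerRes ψ).ρ p (a q) + u' (p, q)) := by
    rw [← kerIncl_ρ (hP p), ← kerIncl_add, twist_factor, ← mul_assoc,
      (commute_kerIncl _ _).eq, mul_assoc, ← kerIncl_add]
  rw [hl, hr, mul_right_inj, kerIncl_injective.eq_iff, d₁₂_hom_apply]
  rw [eq_sub_iff_add_eq, ← add_sub_right_comm, ← add_sub_right_comm, sub_eq_iff_eq_add, eq_comm,
    add_comm (a p)]

theorem twist_cohomologous_twist_iff (hP : P.Induces ψ) (u u' : Q × Q → X.kerRes ψ) :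
    (P.twist u).Cohomologous (P.twist u') ↔ u - u' ∈ coboundaries₂ (X.kerRes ψ) := by
  constructor
  · rintro ⟨h, hrep, hfactor⟩
    have d_h (q : Q) : X.d (h q) = 1 := mul_eq_right.mp (hrep q).symm
    choose a ha using fun q => exists_kerIncl_eq ψ (d_h q)
    obtain rfl : (fun q => kerIncl (a q)) = h := funext ha
    exact ⟨a, funext fun g => (twist_factor_mul_kerIncl_iff hP u u' a g.1 g.2).mp (hfactor _ _)⟩
  · rintro ⟨a, ha⟩
    refine ⟨fun q => kerIncl (a q), fun q => by simp [d_kerIncl], fun p q => ?_⟩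
    exact (twist_factor_mul_kerIncl_iff hP u u' a p q).mpr (congrFun ha (p, q))

end PreFactorSet

namespace FactorSet

theorem hasObstruction_zero (F : FactorSet X Q) (ψ : Q →* X.Coker) :
    F.HasObstruction (0 : Q × Q × Q → X.kerRes ψ) := fun p q r =>
  (F.isCocycle p q r).trans (mul_one _).symm

/-- Multiplication of a factor set by a 2-cocycle with values in `Ker d`. -/
def twistCocycle (F : FactorSet X Q) (hF : F.Induces ψ) (z : cocycles₂ (X.kerRes ψ)) :
    FactorSet X Q where
  toPreFactorSet := F.twist z.1
  isCocycle := ((F.hasObstruction_zero ψ).twist_isCocycle_iff hF z.1).mpr z.2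

end FactorSet

theorem exists_twist_equivalent {P : PreFactorSet X Q} (hP : P.Induces ψ)
    {ℰ : X.Extension Q} (hℰ : ℰ.Induces ψ) :
    ∃ (u : Q × Q → X.kerRes ψ) (hu : (P.twist u).IsCocycle),
      (FactorSet.mk (P.twist u) hu).extension.Equivalent ℰ := by
  obtain ⟨s, hs⟩ := hℰ.exists_section hP
  have hrep : (Extension.factorSet s).rep = P.rep := funext hs
  have h := Extension.factorSet_extension_equivalent s
  generalize Extension.factorSet s = F at hrep h
  obtain ⟨P', isCocycle⟩ := F
  obtain ⟨u, rfl⟩ := PreFactorSet.exists_eq_twist ψ hrep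
  exact ⟨u, isCocycle, h⟩

theorem exists_extension_induces_iff {P : PreFactorSet X Q} (hP : P.Induces ψ)
    {k : Q × Q × Q → X.kerRes ψ} (hk : P.HasObstruction k) :
    (∃ ℰ : X.Extension Q, ℰ.Induces ψ) ↔ ∃ u, d₂₃ (X.kerRes ψ) u = k := by
  simp only [← hk.twist_isCocycle_iff hP]
  constructor
  · rintro ⟨ℰ, hℰ⟩
    obtain ⟨u, hu, -⟩ := exists_twist_equivalent hP hℰ
    exact ⟨u, hu⟩
  · rintro ⟨u, hu⟩
    exact ⟨FactorSet.extension ⟨P.twist u, hu⟩, FactorSet.extension_induces hP⟩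

theorem exists_twistCocycle_equivalent {F : FactorSet X Q} (hF : F.Induces ψ)
    {ℰ : X.Extension Q} (hℰ : ℰ.Induces ψ) :
    ∃ z, (F.twistCocycle hF z).extension.Equivalent ℰ := by
  obtain ⟨u, hu, h⟩ := exists_twist_equivalent hF hℰ
  exact ⟨⟨u, ((F.hasObstruction_zero ψ).twist_isCocycle_iff hF u).mp hu⟩, h⟩

theorem twistCocycle_equivalent_iff {F : FactorSet X Q} (hF : F.Induces ψ)
    (z z' : cocycles₂ (X.kerRes ψ)) :
    (F.twistCocycle hF z).extension.Equivalent (F.twistCocycle hF z').extension ↔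
      H2π (X.kerRes ψ) z = H2π (X.kerRes ψ) z' := by
  rw [FactorSet.extension_equivalent_iff, H2π_eq_iff]
  exact PreFactorSet.twist_cohomologous_twist_iff hF z.1 z'.1

/-- The extensions of type `X` inducing `ψ` form a torsor under `H²_ψ(Q, Ker d)`, which an
extension `ℰ` identifies with `H²_ψ(Q, Ker d)`. -/
noncomputable def extEquivH2 {ℰ : X.Extension Q} (hℰ : ℰ.Induces ψ) :
    X.Ext ψ ≃ groupCohomology (X.kerRes ψ) 2 :=
  have hF := hℰ.factorSet ℰ.seq.surjInvRightHom
  let toExt (z : cocycles₂ (X.kerRes ψ)) : X.Ext ψ :=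
    ⟦⟨_, FactorSet.extension_induces (F := FactorSet.twistCocycle _ hF z) hF⟩⟧
  have toExt_surjective : Function.Surjective toExt := Quotient.ind fun ℰ' =>
    (exists_twistCocycle_equivalent hF ℰ'.2).imp fun _ => Quotient.sound (s := X.extSetoid ψ)
  have same_fibres (z z') : Setoid.ker toExt z z' ↔ Setoid.ker (H2π (X.kerRes ψ)) z z' :=
    Quotient.eq.trans (twistCocycle_equivalent_iff hF z z')
  (Setoid.quotientKerEquivOfSurjective _ toExt_surjective).symm.trans <|
    (Quotient.congrRight same_fibres).trans
      (Setoid.quotientKerEquivOfSurjective _ (groupCohomology_H2π_surjective _))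

end Twist

/-! ### The obstruction of a stick -/

section Stick

open groupCohomology

variable (σ : X.Stick) (ψ : Q →* X.Coker)

/-- The representatives and factors over `ψ` given by a stick. Since `σ.lab s t` is the label of an
isomorphism `x_{st} → x_s ⊗ x_t`, the factors are the inverses of the labels. -/
@[simps]
def Stick.preFactorSet : PreFactorSet X Q where
  rep q := (σ.obj (ψ q)).val
  factor p q := (σ.lab (ψ p) (ψ q))⁻¹
  rep_mul_rep p q := by rw [map_mul, σ.lab_eq, map_inv, inv_mul_cancel_left]

theorem Stick.preFactorSet_induces : (σ.preFactorSet ψ).Induces ψ := fun q => σ.cls_obj (ψ q)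

/-- The cochain `ψ*k` on `Q`. -/
noncomputable def Stick.pullback (g : Q × Q × Q) : X.kerRes ψ :=
  (Additive.ofMul (σ.k (ψ g.1) (ψ g.2.1) (ψ g.2.2)) : Additive X.d.ker)

theorem Stick.preFactorSet_hasObstruction : (σ.preFactorSet ψ).HasObstruction (σ.pullback ψ) := by
  intro p q r
  simp only [preFactorSet_factor, preFactorSet_rep, map_inv, map_mul ψ, ← mul_inv_rev, ← σ.k_mul]
  symm
  rw [mul_inv_rev]
  exact inv_mul_cancel_right _ _

theorem Stick.iCocycles_cocyclesMap_cocycle :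
    iCocycles (X.kerRes ψ) 3 (cocyclesMap ψ (𝟙 (X.kerRes ψ)) 3 σ.cocycle) =
      (cochainsIso₃ (X.kerRes ψ)).inv (σ.pullback ψ) := by
  have iCocycles_cocycle : iCocycles X.kerRep 3 σ.cocycle = fun g : Fin 3 → X.Coker =>
      (Additive.ofMul (σ.k (g 0) (g 1) (g 2)) : Additive X.d.ker) := by
    unfold Stick.cocycle
    exact iCocycles_mk _ _
  rw [← ConcreteCategory.comp_apply, HomologicalComplex.cyclesMap_i, ConcreteCategory.comp_apply,
    iCocycles_cocycle]
  rfl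

theorem obstruction_eq_zero_iff :
    obstruction σ ψ = 0 ↔ ∃ u, d₂₃ (X.kerRes ψ) u = σ.pullback ψ := by
  rw [obstruction, groupCohomology_π_three_eq_zero_iff, σ.iCocycles_cocyclesMap_cocycle,
    Iso.inv_hom_id_apply]

end Stick

end CrossedModule

theorem mainTheorem2 {B D Q : Type u} [Group B] [Group D] [Group Q] (X : CrossedModule B D)
    (σ : X.Stick) (ψ : Q →* X.Coker) :
    (CrossedModule.obstruction σ ψ = 0 ↔ ∃ ℰ : X.Extension Q, ℰ.Induces ψ) ∧
    (CrossedModule.obstruction σ ψ = 0 →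
      Nonempty (X.Ext ψ ≃ groupCohomology (X.kerRes ψ) 2)) := by
  have exists_extension_iff :
      CrossedModule.obstruction σ ψ = 0 ↔ ∃ ℰ : X.Extension Q, ℰ.Induces ψ := by
    rw [CrossedModule.obstruction_eq_zero_iff, CrossedModule.exists_extension_induces_iff
      (σ.preFactorSet_induces ψ) (σ.preFactorSet_hasObstruction ψ)]
  refine ⟨exists_extension_iff, fun h => ?_⟩
  obtain ⟨ℰ, hℰ⟩ := exists_extension_iff.mp h
  exact ⟨CrossedModule.extEquivH2 hℰ⟩
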